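/- Let $k\ge 1$ be an integer, and for real $q\in(0,1)$ put $$H_k(q)=\sum_{r,s\ge 0}\frac{(-1)^s\,q^{\frac{k(k+1)(r+s)^2}{2}+\frac{(k+1)s(s+1)}{2}}}{(q^k;q^k)_r\,(q^{k+1};q^{k+1})_s},\qquad (a;q)_n=\prod_{j=0}^{n-1}(1-aq^j),$$ where the double series converges absolutely. Then, with $q=e^{-\varepsilon}$, as $\varepsilon\to0^+$, $$H_k(q)=\sqrt2\,e^{\frac{\pi^2}{12k(k+1)\varepsilon}}\left(1+O\left(\varepsilon^{1/2}\right)\right),$$ where the implied constant may depend on $k$. -/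

import Mathlib

open Filter Topology Asymptotics

namespace RunOverpartition

/-- The finite `q`-Pochhammer symbol `(a; q)_n = ∏_{j = 0}^{n - 1} (1 - a q ^ j)`. -/
def qPoch (a q : ℝ) (n : ℕ) : ℝ :=
  ∏ j ∈ Finset.range n, (1 - a * q ^ j)

/-- The exponent `k (k + 1) (r + s)² / 2 + (k + 1) s (s + 1) / 2`. Both numerators are even, so
the divisions in `ℕ` are exact (see `two_mul_exponent`). -/
def exponent (k r s : ℕ) : ℕ :=
  k * (k + 1) * (r + s) ^ 2 / 2 + (k + 1) * (s * (s + 1)) / 2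

theorem two_mul_exponent (k r s : ℕ) :
    2 * exponent k r s = k * (k + 1) * (r + s) ^ 2 + (k + 1) * (s * (s + 1)) := by
  have h1 : 2 ∣ k * (k + 1) * (r + s) ^ 2 :=
    Dvd.dvd.mul_right (Nat.even_mul_succ_self k).two_dvd _
  have h2 : 2 ∣ (k + 1) * (s * (s + 1)) :=
    Dvd.dvd.mul_left (Nat.even_mul_succ_self s).two_dvd _
  rw [exponent, mul_add, Nat.mul_div_cancel' h1, Nat.mul_div_cancel' h2]

/-- The `(r, s)` term of the double series. -/
noncomputable def term (k : ℕ) (q : ℝ) (p : ℕ × ℕ) : ℝ :=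
  (-1) ^ p.2 * q ^ exponent k p.1 p.2 /
    (qPoch (q ^ k) (q ^ k) p.1 * qPoch (q ^ (k + 1)) (q ^ (k + 1)) p.2)

/-- The double series `H_k(q)`, summed over all pairs `r, s ≥ 0`. -/
noncomputable def H (k : ℕ) (q : ℝ) : ℝ :=
  ∑' p : ℕ × ℕ, term k q p

end RunOverpartition

/-!
With `q = e^{-ε}` and `A = k (k + 1) ε`, the terms of the double series are the coefficients
`a_r b_s` of the Euler expansions of `1 / (z; q^k)_∞` and `(q^{k+1} z; q^{k+1})_∞`, multiplied by
the Gaussian `exp (-A (r + s)² / 2)`. Writing that Gaussian as a Fourier integral over the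
circle `z = e^{iv} / 2` turns the double series into

`H = (2 π A)^{-1/2} ∫ G(z) exp (-(v + i log 2)² / (2 A)) dv`,
`G(z) = (q^{k+1} z; q^{k+1})_∞ / (z; q^k)_∞`

(`hasSum_term`, with `v = √A w`). Since `1 / (1 - e^{-x}) = 1/x + 1/2 + O(x)` uniformly in `x > 0`,
`log G(z) = Li₂(z) / A - log (1 - z) + O(ε)` uniformly on `|z| = 1/2`. The radius `1/2` is chosen
because `z = 1/2` is the saddle point: there the linear terms in `v` cancel, the
quadratic terms add up to `-v² / A`, and the value of the exponent is
`(Li₂(1/2) + (log 2)² / 2) / A = π² / (12 A)` by `dilog_half`. The factor `1 / (1 - z) = 2` and the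
Gaussian integral then give the main term `√2 exp (π² / (12 A))`.

What remains of the exponent is `saddleError`, of size `O(|v|³ / A + |v| + ε)` by
`norm_saddleError_le`. As `Re Li₂(z) ≤ Li₂(|z|)`, its real part is at most `v² / (2 A) + O(ε)`
(`re_saddleError_le`), so the integrand is dominated by a Gaussian on the whole line and the
relative error is `O(√A)`, with no separate treatment of the tails.

Infinite products are avoided: `eulerSeries_eq_exp` and `eulerSeries'_eq_exp` identify Euler's
series with exponentials of logarithmic series through the functional equation
`f (p z) = (1 - z) f z` and continuity at `0`.
-/

namespace RunOverpartition

/-! ### Power series on the disc of radius one half -/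

section PowerSeries

variable {c : ℕ → ℂ}

theorem norm_coeff_mul_pow_le {z : ℂ} (hz : ‖z‖ ≤ 1 / 2) (n : ℕ) :
    ‖c n * z ^ n‖ ≤ ‖c n‖ * (1 / 2) ^ n := by
  rw [norm_mul, norm_pow]
  gcongr

theorem summable_norm_coeff_mul_pow (hc : Summable fun n => ‖c n‖ * (1 / 2 : ℝ) ^ n) {z : ℂ}
    (hz : ‖z‖ ≤ 1 / 2) : Summable fun n => ‖c n * z ^ n‖ :=
  hc.of_nonneg_of_le (fun _ => norm_nonneg _) (norm_coeff_mul_pow_le hz)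

theorem summable_coeff_mul_pow (hc : Summable fun n => ‖c n‖ * (1 / 2 : ℝ) ^ n) {z : ℂ}
    (hz : ‖z‖ ≤ 1 / 2) : Summable fun n => c n * z ^ n :=
  (summable_norm_coeff_mul_pow hc hz).of_norm

theorem continuousOn_powerSeries (hc : Summable fun n => ‖c n‖ * (1 / 2 : ℝ) ^ n) :
    ContinuousOn (fun z : ℂ => ∑' n, c n * z ^ n) (Metric.closedBall 0 (1 / 2)) :=
  continuousOn_tsum (fun n => by fun_prop) hc
    (fun n z hz => norm_coeff_mul_pow_le (mem_closedBall_zero_iff.1 hz) n)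

theorem powerSeries_zero : ∑' n, c n * (0 : ℂ) ^ n = c 0 := by
  rw [tsum_eq_single 0 (fun n hn => by simp [hn])]
  simp

theorem norm_dilate_le {p : ℝ} (hp0 : 0 < p) (hp1 : p < 1) {z : ℂ} (hz : ‖z‖ ≤ 1 / 2) :
    ‖(p : ℂ) * z‖ ≤ 1 / 2 := by
  rw [norm_mul, Complex.norm_real, Real.norm_of_nonneg hp0.le]
  nlinarith [norm_nonneg z]

/-- A function on the disc `‖z‖ ≤ 1 / 2` that is invariant under `z ↦ p z` and continuous is
constant, because `p ^ n z → 0`. -/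
theorem eq_zero_value_of_dilation_invariant {p : ℝ} (hp0 : 0 < p) (hp1 : p < 1) {h : ℂ → ℂ}
    (hcont : ContinuousOn h (Metric.closedBall 0 (1 / 2)))
    (hinv : ∀ z : ℂ, ‖z‖ ≤ 1 / 2 → h (p * z) = h z) {z : ℂ} (hz : ‖z‖ ≤ 1 / 2) :
    h z = h 0 := by
  have hmem : ∀ n : ℕ, ‖(p : ℂ) ^ n * z‖ ≤ 1 / 2 ∧ h ((p : ℂ) ^ n * z) = h z := by
    intro n
    induction n with
    | zero => simpa using hz
    | succ n ih =>
      have e : (p : ℂ) ^ (n + 1) * z = p * (p ^ n * z) := by ring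
      rw [e]
      exact ⟨norm_dilate_le hp0 hp1 ih.1, (hinv _ ih.1).trans ih.2⟩
  have hp : Tendsto (fun n : ℕ => (p : ℂ) ^ n * z) atTop (𝓝 0) := by
    have : Tendsto (fun n : ℕ => (p : ℂ) ^ n) atTop (𝓝 0) := by
      apply tendsto_pow_atTop_nhds_zero_of_norm_lt_one
      rwa [Complex.norm_real, Real.norm_of_nonneg hp0.le]
    simpa using this.mul_const z
  have hw : Tendsto (fun n : ℕ => (p : ℂ) ^ n * z) atTop
      (𝓝[Metric.closedBall 0 (1 / 2)] 0) :=
    tendsto_nhdsWithin_iff.2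
      ⟨hp, Eventually.of_forall fun n => mem_closedBall_zero_iff.2 (hmem n).1⟩
  have h1 := (hcont 0 (by simp)).tendsto.comp hw
  have h2 : (h ∘ fun n : ℕ => (p : ℂ) ^ n * z) = fun _ => h z := by
    funext n
    exact (hmem n).2
  rw [h2] at h1
  exact tendsto_nhds_unique tendsto_const_nhds h1

end PowerSeries

/-! ### Euler's expansions in exponential form -/

section Euler

variable {p : ℝ}

theorem qPoch_succ (a q : ℝ) (n : ℕ) : qPoch a q (n + 1) = qPoch a q n * (1 - a * q ^ n) := by
  simp [qPoch, Finset.prod_range_succ]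

theorem one_sub_pow_pos (hp0 : 0 < p) (hp1 : p < 1) (n : ℕ) : 0 < 1 - p ^ (n + 1) :=
  sub_pos.2 (pow_lt_one₀ hp0.le hp1 n.succ_ne_zero)

theorem qPoch_pos (hp0 : 0 < p) (hp1 : p < 1) (n : ℕ) : 0 < qPoch p p n := by
  refine Finset.prod_pos fun j _ => ?_
  have := one_sub_pow_pos hp0 hp1 j
  rwa [pow_succ'] at this

/-- The coefficients `1 / (p; p)_n` of Euler's expansion of `1 / (z; p)_∞`. -/
noncomputable def eulerCoeff (p : ℝ) (n : ℕ) : ℝ := (qPoch p p n)⁻¹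

/-- The coefficients `(-1)^n p^(n(n+1)/2) / (p; p)_n` of Euler's expansion of `(p z; p)_∞`. -/
noncomputable def eulerCoeff' (p : ℝ) (n : ℕ) : ℝ :=
  (-1) ^ n * p ^ (n * (n + 1) / 2) * eulerCoeff p n

theorem eulerCoeff_zero : eulerCoeff p 0 = 1 := by simp [eulerCoeff, qPoch]

theorem eulerCoeff'_zero : eulerCoeff' p 0 = 1 := by simp [eulerCoeff', eulerCoeff_zero]

theorem eulerCoeff_pos (hp0 : 0 < p) (hp1 : p < 1) (n : ℕ) : 0 < eulerCoeff p n :=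
  inv_pos.2 (qPoch_pos hp0 hp1 n)

theorem eulerCoeff_succ (hp0 : 0 < p) (hp1 : p < 1) (n : ℕ) :
    eulerCoeff p (n + 1) * (1 - p ^ (n + 1)) = eulerCoeff p n := by
  have h1 := (one_sub_pow_pos hp0 hp1 n).ne'
  have h2 := (qPoch_pos hp0 hp1 n).ne'
  rw [eulerCoeff, eulerCoeff, qPoch_succ, ← pow_succ']
  field_simp

theorem eulerCoeff'_succ (hp0 : 0 < p) (hp1 : p < 1) (n : ℕ) :
    eulerCoeff' p (n + 1) * (1 - p ^ (n + 1)) = -p ^ (n + 1) * eulerCoeff' p n := by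
  have e : (n + 1) * (n + 1 + 1) / 2 = n * (n + 1) / 2 + (n + 1) := by
    rw [show (n + 1) * (n + 1 + 1) = n * (n + 1) + (n + 1) * 2 by ring,
      Nat.add_mul_div_right _ _ two_pos]
  rw [eulerCoeff', eulerCoeff', mul_assoc, eulerCoeff_succ hp0 hp1, e, pow_succ, pow_add]
  ring

theorem summable_eulerCoeff (hp0 : 0 < p) (hp1 : p < 1) :
    Summable fun n => ‖((eulerCoeff p n : ℝ) : ℂ)‖ * (1 / 2 : ℝ) ^ n := by
  refine summable_of_ratio_norm_eventually_le (r := 3 / 4) (by norm_num) ?_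
  have ht : Tendsto (fun n : ℕ => p ^ (n + 1)) atTop (𝓝 0) :=
    (tendsto_pow_atTop_nhds_zero_of_lt_one hp0.le hp1).comp (tendsto_add_atTop_nat 1)
  filter_upwards [ht.eventually_le_const (show (0 : ℝ) < 1 / 3 by norm_num)] with n hn
  have h0 := eulerCoeff_pos hp0 hp1 n
  have h1 := eulerCoeff_pos hp0 hp1 (n + 1)
  simp only [Complex.norm_real, norm_mul, norm_norm, norm_pow]
  rw [Real.norm_of_nonneg h0.le, Real.norm_of_nonneg h1.le, ← eulerCoeff_succ hp0 hp1 n,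
    Real.norm_of_nonneg (by norm_num : (0 : ℝ) ≤ 1 / 2), pow_succ]
  have h2 : 0 < eulerCoeff p (n + 1) * (1 / 2) ^ n := by positivity
  nlinarith

theorem summable_eulerCoeff' (hp0 : 0 < p) (hp1 : p < 1) :
    Summable fun n => ‖((eulerCoeff' p n : ℝ) : ℂ)‖ * (1 / 2 : ℝ) ^ n := by
  refine (summable_eulerCoeff hp0 hp1).of_nonneg_of_le (fun n => by positivity) fun n => ?_
  gcongr
  rw [Complex.norm_real, Complex.norm_real, eulerCoeff', norm_mul, norm_mul, norm_pow, norm_neg,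
    norm_one, one_pow, one_mul, norm_pow, Real.norm_of_nonneg hp0.le]
  exact mul_le_of_le_one_left (norm_nonneg _) (pow_le_one₀ hp0.le hp1.le)

/-- The logarithm `∑ z^m / (m (1 - p^m))` of `1 / (z; p)_∞`; the term `m = 0` is `0`. -/
noncomputable def qLog (p : ℝ) (z : ℂ) : ℂ :=
  ∑' m : ℕ, (((m : ℝ) * (1 - p ^ m))⁻¹ : ℝ) * z ^ m

theorem summable_qLog_coeff (hp0 : 0 < p) (hp1 : p < 1) :
    Summable fun m : ℕ => ‖((((m : ℝ) * (1 - p ^ m))⁻¹ : ℝ) : ℂ)‖ * (1 / 2 : ℝ) ^ m := by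
  refine ((summable_geometric_of_lt_one (r := 1 / 2) (by norm_num)
    (by norm_num)).mul_left (1 - p)⁻¹).of_nonneg_of_le (fun n => by positivity) fun n => ?_
  gcongr
  have hp : 0 < 1 - p := sub_pos.2 hp1
  rcases n with _ | n
  · simp [hp.le]
  have h1 : p ^ (n + 1) ≤ p := pow_le_of_le_one hp0.le hp1.le n.succ_ne_zero
  have h2 : (1 : ℝ) ≤ ((n + 1 : ℕ) : ℝ) := by simp
  rw [Complex.norm_real, Real.norm_of_nonneg
    (inv_nonneg.2 (mul_nonneg (by positivity) (by linarith)))]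
  refine inv_anti₀ hp ?_
  nlinarith

theorem qLog_zero : qLog p 0 = 0 := by
  rw [qLog, powerSeries_zero]
  simp

theorem qLog_sub_dilate (hp0 : 0 < p) (hp1 : p < 1) {z : ℂ} (hz : ‖z‖ ≤ 1 / 2) :
    qLog p z - qLog p (p * z) = -Complex.log (1 - z) := by
  have hs := summable_qLog_coeff hp0 hp1
  rw [qLog, qLog, ← (summable_coeff_mul_pow hs hz).tsum_sub
    (summable_coeff_mul_pow hs (norm_dilate_le hp0 hp1 hz)),
    ← (Complex.hasSum_taylorSeries_neg_log (lt_of_le_of_lt hz (by norm_num))).tsum_eq]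
  refine tsum_congr fun n => ?_
  rcases n with _ | n
  · simp
  have h1 : (1 - (p : ℂ) ^ (n + 1)) ≠ 0 := by
    exact_mod_cast (one_sub_pow_pos hp0 hp1 n).ne'
  have h2 : ((n : ℂ) + 1) ≠ 0 := Nat.cast_add_one_ne_zero n
  push_cast
  rw [mul_pow]
  field_simp

theorem one_sub_ne_zero_of_norm_le {z : ℂ} (hz : ‖z‖ ≤ 1 / 2) : 1 - z ≠ 0 := by
  intro h
  rw [← sub_eq_zero.1 h] at hz
  norm_num at hz

theorem exp_qLog_dilate (hp0 : 0 < p) (hp1 : p < 1) {z : ℂ} (hz : ‖z‖ ≤ 1 / 2) :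
    Complex.exp (qLog p (p * z)) = (1 - z) * Complex.exp (qLog p z) := by
  have h := qLog_sub_dilate hp0 hp1 hz
  rw [show qLog p (p * z) = Complex.log (1 - z) + qLog p z by linear_combination -h,
    Complex.exp_add, Complex.exp_log (one_sub_ne_zero_of_norm_le hz)]

theorem eulerSeries_dilate (hp0 : 0 < p) (hp1 : p < 1) {z : ℂ} (hz : ‖z‖ ≤ 1 / 2) :
    ∑' n, (eulerCoeff p n : ℂ) * (p * z) ^ n = (1 - z) * ∑' n, (eulerCoeff p n : ℂ) * z ^ n := by
  have hs := summable_eulerCoeff hp0 hp1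
  have h1 := summable_coeff_mul_pow hs hz
  have h2 := summable_coeff_mul_pow hs (norm_dilate_le hp0 hp1 hz)
  have h3 : ∑' n, (eulerCoeff p n : ℂ) * z ^ n - ∑' n, (eulerCoeff p n : ℂ) * (p * z) ^ n =
      z * ∑' n, (eulerCoeff p n : ℂ) * z ^ n := by
    rw [← h1.tsum_sub h2, (h1.sub h2).tsum_eq_zero_add, ← tsum_mul_left]
    simp only [pow_zero, sub_self, zero_add]
    refine tsum_congr fun n => ?_
    rw [← eulerCoeff_succ hp0 hp1 n]
    push_cast
    ring
  linear_combination -h3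

theorem eulerSeries'_dilate (hp0 : 0 < p) (hp1 : p < 1) {z : ℂ} (hz : ‖z‖ ≤ 1 / 2) :
    ∑' n, (eulerCoeff' p n : ℂ) * z ^ n =
      (1 - p * z) * ∑' n, (eulerCoeff' p n : ℂ) * (p * z) ^ n := by
  have hs := summable_eulerCoeff' hp0 hp1
  have h1 := summable_coeff_mul_pow hs hz
  have h2 := summable_coeff_mul_pow hs (norm_dilate_le hp0 hp1 hz)
  have h3 : ∑' n, (eulerCoeff' p n : ℂ) * z ^ n - ∑' n, (eulerCoeff' p n : ℂ) * (p * z) ^ n =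
      -(p * z) * ∑' n, (eulerCoeff' p n : ℂ) * (p * z) ^ n := by
    rw [← h1.tsum_sub h2, (h1.sub h2).tsum_eq_zero_add, ← tsum_mul_left]
    simp only [pow_zero, sub_self, zero_add]
    refine tsum_congr fun n => ?_
    have h : (eulerCoeff' p (n + 1) : ℂ) * (1 - p ^ (n + 1)) =
      -p ^ (n + 1) * eulerCoeff' p n := by exact_mod_cast eulerCoeff'_succ hp0 hp1 n
    linear_combination z ^ (n + 1) * h
  linear_combination h3

/-- Euler's expansion of `1 / (z; p)_∞`, with the product replaced by the exponential of its
logarithmic series: both sides satisfy `f (p z) = (1 - z) f z`. -/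
theorem eulerSeries_eq_exp (hp0 : 0 < p) (hp1 : p < 1) {z : ℂ} (hz : ‖z‖ ≤ 1 / 2) :
    ∑' n, (eulerCoeff p n : ℂ) * z ^ n = Complex.exp (qLog p z) := by
  have h := eq_zero_value_of_dilation_invariant hp0 hp1
    (h := fun z => (∑' n, (eulerCoeff p n : ℂ) * z ^ n) * Complex.exp (-qLog p z))
    ((continuousOn_powerSeries (summable_eulerCoeff hp0 hp1)).mul
      (continuousOn_powerSeries (summable_qLog_coeff hp0 hp1)).neg.cexp) ?_ hz
  · simp only [powerSeries_zero, eulerCoeff_zero, qLog_zero] at h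
    rw [Complex.exp_neg, ← div_eq_mul_inv, div_eq_iff (Complex.exp_ne_zero _)] at h
    simpa using h
  · intro w hw
    have h0 := one_sub_ne_zero_of_norm_le hw
    have h1 := Complex.exp_ne_zero (qLog p w)
    simp only [Complex.exp_neg]
    rw [eulerSeries_dilate hp0 hp1 hw, exp_qLog_dilate hp0 hp1 hw]
    field_simp

/-- Euler's expansion of `(p z; p)_∞`, in exponential form. -/
theorem eulerSeries'_eq_exp (hp0 : 0 < p) (hp1 : p < 1) {z : ℂ} (hz : ‖z‖ ≤ 1 / 2) :
    ∑' n, (eulerCoeff' p n : ℂ) * z ^ n = Complex.exp (-qLog p (p * z)) := by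
  have hmaps : Set.MapsTo (fun z : ℂ => (p : ℂ) * z) (Metric.closedBall 0 (1 / 2))
      (Metric.closedBall 0 (1 / 2)) := fun w hw =>
    mem_closedBall_zero_iff.2 (norm_dilate_le hp0 hp1 (mem_closedBall_zero_iff.1 hw))
  have h := eq_zero_value_of_dilation_invariant hp0 hp1
    (h := fun z => (∑' n, (eulerCoeff' p n : ℂ) * z ^ n) * Complex.exp (qLog p (p * z)))
    ((continuousOn_powerSeries (summable_eulerCoeff' hp0 hp1)).mul
      ((continuousOn_powerSeries (summable_qLog_coeff hp0 hp1)).comp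
        (by fun_prop) hmaps).cexp) ?_ hz
  · simp only [powerSeries_zero, eulerCoeff'_zero, mul_zero, qLog_zero] at h
    rw [Complex.exp_neg]
    exact eq_inv_of_mul_eq_one_left (by simpa using h)
  · intro w hw
    rw [exp_qLog_dilate hp0 hp1 (norm_dilate_le hp0 hp1 hw), eulerSeries'_dilate hp0 hp1 hw]
    ring

end Euler

/-! ### The dilogarithm at one half -/

section Dilogarithm

/-- The dilogarithm `Li₂ x = ∑_{n ≥ 1} x^n / n^2` on `[-1, 1]`; the term `n = 0` is `0`. -/
noncomputable def dilog (x : ℝ) : ℝ := ∑' n : ℕ, x ^ n / (n : ℝ) ^ 2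

theorem norm_dilog_term_le {x : ℝ} (hx : |x| ≤ 1) (n : ℕ) :
    ‖x ^ n / (n : ℝ) ^ 2‖ ≤ 1 / (n : ℝ) ^ 2 := by
  rw [norm_div, norm_pow, Real.norm_eq_abs, Real.norm_of_nonneg (by positivity)]
  gcongr
  exact pow_le_one₀ (abs_nonneg x) hx

theorem continuousOn_dilog : ContinuousOn dilog (Set.Icc (-1) 1) :=
  continuousOn_tsum (fun n => by fun_prop) hasSum_zeta_two.summable
    (fun n _ hx => norm_dilog_term_le (abs_le.2 hx) n)

theorem hasDerivAt_dilog {x : ℝ} (hx0 : 0 < x) (hx1 : x < 1) :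
    HasDerivAt dilog (-Real.log (1 - x) / x) x := by
  obtain ⟨r, hxr, hr1⟩ := exists_between hx1
  have hr0 : 0 < r := hx0.trans hxr
  have hxb : |x| < 1 := by rwa [abs_of_pos hx0]
  have hu : Summable fun n : ℕ => r ^ (n - 1) := by
    rw [← summable_nat_add_iff 1]
    simpa using summable_geometric_of_lt_one hr0.le hr1
  have h := hasDerivAt_tsum_of_isPreconnected (𝕜 := ℝ) (F := ℝ)
    (g := fun (n : ℕ) y => y ^ n / (n : ℝ) ^ 2) (g' := fun (n : ℕ) y => n * y ^ (n - 1) / (n : ℝ) ^ 2)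
    (t := Metric.ball 0 r) (y₀ := x) (y := x) hu Metric.isOpen_ball
    (convex_ball (0 : ℝ) r).isPreconnected
    (fun n y _ => (hasDerivAt_pow n y).div_const _) ?_
    (by simpa [abs_of_pos hx0] using hxr)
    (hasSum_zeta_two.summable.of_norm_bounded (norm_dilog_term_le hxb.le))
    (by simpa [abs_of_pos hx0] using hxr)
  · convert! h using 1
    have hs := (Real.hasSum_pow_div_log_of_abs_lt_one hxb).div_const x
    rw [← hs.tsum_eq]
    have hs' : Summable fun n : ℕ => (n : ℝ) * x ^ (n - 1) / (n : ℝ) ^ 2 := by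
      rw [← summable_nat_add_iff 1]
      refine hs.summable.congr fun n => ?_
      have : (n : ℝ) + 1 ≠ 0 := n.cast_add_one_ne_zero
      simp only [Nat.cast_add, Nat.cast_one, Nat.add_sub_cancel]
      field_simp
      ring
    rw [hs'.tsum_eq_zero_add]
    simp only [Nat.cast_zero, zero_mul, zero_div, zero_add]
    refine tsum_congr fun n => ?_
    have : (n : ℝ) + 1 ≠ 0 := n.cast_add_one_ne_zero
    simp only [Nat.cast_add, Nat.cast_one, Nat.add_sub_cancel]
    field_simp
    ring
  · intro n y hy
    have hy' : |y| ≤ r := by simpa using (mem_ball_zero_iff.1 hy).le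
    rcases n with _ | n
    · simp
    · have hn : (1 : ℝ) ≤ ((n + 1 : ℕ) : ℝ) := by simp
      rw [norm_div, norm_mul, norm_pow, norm_pow, Real.norm_eq_abs y,
        Real.norm_of_nonneg (by positivity), div_le_iff₀ (by positivity), Nat.add_sub_cancel]
      have h1 : |y| ^ n ≤ r ^ n := by gcongr
      have h2 : (0 : ℝ) ≤ r ^ n := by positivity
      nlinarith [mul_nonneg h2 (sub_nonneg.2 hn), mul_le_mul_of_nonneg_left h1
        (by positivity : (0 : ℝ) ≤ ((n + 1 : ℕ) : ℝ)),
        mul_nonneg (mul_nonneg h2 (sub_nonneg.2 hn)) (by positivity : (0 : ℝ) ≤ ((n + 1 : ℕ) : ℝ))]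

theorem continuousOn_log_mul_log_one_sub :
    ContinuousOn (fun x => Real.log x * Real.log (1 - x)) (Set.Icc 0 (1 / 2)) := by
  intro x hx
  rcases eq_or_lt_of_le hx.1 with h0 | h0
  · subst h0
    have hb : ∀ y ∈ Set.Icc (0 : ℝ) (1 / 2),
        ‖Real.log y * Real.log (1 - y)‖ ≤ 2 * ‖y * Real.log y‖ := by
      intro y hy
      have h1 : 0 < 1 - y := by linarith [hy.2]
      have h2 : Real.log (1 - y) ≤ 0 := Real.log_nonpos h1.le (by linarith [hy.1])
      have h3 : -(2 * y) ≤ Real.log (1 - y) := by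
        refine le_trans ?_ (Real.one_sub_inv_le_log_of_pos h1)
        have : (1 - y)⁻¹ ≤ 1 + 2 * y := by
          rw [inv_le_iff_one_le_mul₀ h1]
          nlinarith [hy.1, hy.2]
        linarith
      rw [norm_mul, norm_mul, Real.norm_of_nonpos h2, Real.norm_of_nonneg hy.1]
      nlinarith [norm_nonneg (Real.log y)]
    have ht : Tendsto (fun y => 2 * ‖y * Real.log y‖) (𝓝[Set.Icc 0 (1 / 2)] 0) (𝓝 0) := by
      have : Continuous fun y => 2 * ‖y * Real.log y‖ := by
        have := Real.continuous_mul_log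
        fun_prop
      simpa using (this.tendsto 0).mono_left nhdsWithin_le_nhds
    have := squeeze_zero_norm' (eventually_nhdsWithin_of_forall hb) ht
    simpa [ContinuousWithinAt] using this
  · have h1 : 1 - x ≠ 0 := by linarith [hx.2]
    exact ((Real.continuousAt_log h0.ne').mul
      ((Real.continuousAt_log h1).comp (by fun_prop))).continuousWithinAt

/-- The value `Li₂ (1/2) = π²/12 - (log 2)²/2`. By the mean value theorem
`Li₂ x + Li₂ (1 - x) + log x * log (1 - x)`, whose derivative vanishes, has the same value at
`0` and at `1/2`. -/
theorem dilog_half : dilog (1 / 2) = Real.pi ^ 2 / 12 - Real.log 2 ^ 2 / 2 := by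
  have hc : ContinuousOn (fun x => dilog x + dilog (1 - x) + Real.log x * Real.log (1 - x))
      (Set.Icc 0 (1 / 2)) := by
    refine ((continuousOn_dilog.mono ?_).add (continuousOn_dilog.comp (by fun_prop) ?_)).add
      continuousOn_log_mul_log_one_sub
    · exact Set.Icc_subset_Icc (by norm_num) (by norm_num)
    · intro x hx
      exact ⟨by linarith [hx.2], by linarith [hx.1]⟩
  obtain ⟨c, -, hcs⟩ := exists_hasDerivAt_eq_slope
    (fun x => dilog x + dilog (1 - x) + Real.log x * Real.log (1 - x)) (fun _ => 0)
    (by norm_num : (0 : ℝ) < 1 / 2) hc (by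
      intro x hx
      have hx0 : 0 < x := hx.1
      have hx1 : 0 < 1 - x := by linarith [hx.2]
      have hsub : HasDerivAt (fun x : ℝ => 1 - x) (-1) x := (hasDerivAt_id x).const_sub 1
      have h1 := hasDerivAt_dilog hx0 (by linarith)
      have h2 := (hasDerivAt_dilog hx1 (by linarith)).comp x hsub
      have h3 := (Real.hasDerivAt_log hx0.ne').mul
        ((Real.hasDerivAt_log hx1.ne').comp x hsub)
      convert! (h1.add h2).add h3 using 1
      rw [sub_sub_cancel]
      simp only [Function.comp]
      field_simp
      ring)
  have h0 : dilog 0 = 0 := by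
    rw [dilog, tsum_eq_single 0 (fun n hn => by simp [hn])]
    simp
  have h1 : dilog 1 = Real.pi ^ 2 / 6 := by
    rw [← hasSum_zeta_two.tsum_eq, dilog]
    simp
  have hl : Real.log (1 / 2) = -Real.log 2 := by rw [one_div, Real.log_inv]
  have hh : (1 : ℝ) - 1 / 2 = 1 / 2 := by norm_num
  simp only [sub_zero, h0, h1, Real.log_zero, zero_mul, hh, hl] at hcs
  rw [eq_div_iff (by norm_num)] at hcs
  linarith

theorem hasSum_half_pow_div_sq :
    HasSum (fun m : ℕ => (1 / 2 : ℝ) ^ m / (m : ℝ) ^ 2)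
      (Real.pi ^ 2 / 12 - Real.log 2 ^ 2 / 2) := by
  rw [← dilog_half]
  exact (hasSum_zeta_two.summable.of_norm_bounded
    (norm_dilog_term_le (by norm_num [abs_of_pos]))).hasSum

theorem hasSum_half_pow_div :
    HasSum (fun m : ℕ => (1 / 2 : ℝ) ^ m / (m : ℝ)) (Real.log 2) := by
  have h := Real.hasSum_pow_div_log_of_abs_lt_one (x := 1 / 2) (by norm_num [abs_of_pos])
  rw [← hasSum_nat_add_iff' 1]
  convert! h using 1
  · funext n
    simp
  · rw [show (1 : ℝ) - 1 / 2 = 2⁻¹ by norm_num, Real.log_inv]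
    simp

theorem hasSum_half_pow_pos :
    HasSum (fun m : ℕ => if m = 0 then 0 else (1 / 2 : ℝ) ^ m) 1 := by
  rw [← hasSum_nat_add_iff' 1]
  convert! (hasSum_geometric_two.mul_left (1 / 2 : ℝ)) using 1
  · funext n
    simp [pow_succ']
  · simp

theorem hasSum_nat_mul_half_pow : HasSum (fun m : ℕ => (m : ℝ) * (1 / 2 : ℝ) ^ m) 2 := by
  convert! hasSum_coe_mul_geometric_of_norm_lt_one (𝕜 := ℝ) (r := 1 / 2) (by norm_num) using 1
  norm_num

end Dilogarithm

/-! ### Taylor bounds -/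

section ElementaryBounds

/-- The expansion `1 / (1 - e^{-x}) = 1/x + 1/2 + O(x)`, uniformly in `x > 0`. -/
theorem abs_inv_one_sub_exp_neg_sub_le {x : ℝ} (hx : 0 < x) :
    |(1 - Real.exp (-x))⁻¹ - 1 / x - 1 / 2| ≤ 2 * x := by
  have h1 : 0 < 1 - Real.exp (-x) := by
    rw [sub_pos, Real.exp_lt_one_iff]
    linarith
  have h2 : 1 - Real.exp (-x) ≤ x := by linarith [Real.add_one_le_exp (-x)]
  have h3 : x ≤ (1 + x) * (1 - Real.exp (-x)) := by
    have : (1 + x) * Real.exp (-x) ≤ 1 := by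
      rw [Real.exp_neg, ← div_eq_mul_inv, div_le_one (Real.exp_pos x)]
      linarith [Real.add_one_le_exp x]
    linarith
  set d := 1 - Real.exp (-x) with hd
  have hxd : 0 < x * d := mul_pos hx h1
  have e : d⁻¹ - 1 / x - 1 / 2 = (x - d - x * d / 2) / (x * d) := by
    field_simp
  rw [e, abs_div, abs_of_pos hxd, div_le_iff₀ hxd]
  rcases le_total x 1 with hx1 | hx1
  · have hb := Real.exp_bound (x := -x) (n := 3) (by rwa [abs_neg, abs_of_pos hx]) (by norm_num)
    rw [abs_neg, abs_of_pos hx] at hb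
    simp [Finset.sum_range_succ, Nat.factorial] at hb
    obtain ⟨hb1, hb2⟩ := abs_le.1 hb
    have hx3 : 0 < x ^ 3 := by positivity
    -- `d = x - x²/2 - r` with `|r| ≤ (2/9) x³`, and `x d ≥ x²/2`
    obtain ⟨r, hr⟩ : ∃ r, r = Real.exp (-x) - (1 - x + x ^ 2 / 2) := ⟨_, rfl⟩
    have hdr : d = x - x ^ 2 / 2 - r := by rw [hd, hr]; ring
    have hr1 : r ≤ 2 / 9 * x ^ 3 := by rw [hr]; linarith
    have hr2 : -(2 / 9 * x ^ 3) ≤ r := by rw [hr]; linarith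
    have hnum : x - d - x * d / 2 = x ^ 3 / 4 + r * (1 + x / 2) := by rw [hdr]; ring
    have hd2 : x / 2 ≤ d := by nlinarith
    have hden : x ^ 3 ≤ 2 * x * (x * d) := by nlinarith [mul_pos hx hx]
    rw [hnum, abs_le]
    constructor <;> nlinarith
  · rw [abs_le]
    constructor <;> nlinarith

theorem norm_exp_mul_I_sub_cubic_le (x : ℝ) :
    ‖Complex.exp (x * Complex.I) - 1 - x * Complex.I + (x : ℂ) ^ 2 / 2‖ ≤ 5 * |x| ^ 3 := by
  rcases le_total |x| 1 with h | h
  · have hb := Complex.exp_bound (x := x * Complex.I) (n := 3) (by simpa using h) (by norm_num)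
    have e : ∑ m ∈ Finset.range 3, ((x : ℂ) * Complex.I) ^ m / (m.factorial : ℂ) =
        1 + x * Complex.I - (x : ℂ) ^ 2 / 2 := by
      simp [Finset.sum_range_succ, Nat.factorial, mul_pow]
      ring
    rw [e] at hb
    have e2 : Complex.exp (x * Complex.I) - 1 - x * Complex.I + (x : ℂ) ^ 2 / 2 =
      Complex.exp (x * Complex.I) - (1 + x * Complex.I - (x : ℂ) ^ 2 / 2) := by ring
    rw [e2]
    refine hb.trans ?_
    rw [norm_mul, Complex.norm_I, mul_one, Complex.norm_real, Real.norm_eq_abs, mul_comm]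
    gcongr
    norm_num [Nat.factorial]
  · have h1 : ‖Complex.exp (x * Complex.I) - 1 - x * Complex.I + (x : ℂ) ^ 2 / 2‖ ≤
        1 + 1 + |x| + |x| ^ 2 / 2 := by
      refine (norm_add_le _ _).trans (add_le_add ((norm_sub_le _ _).trans
        (add_le_add ((norm_sub_le _ _).trans (add_le_add ?_ ?_)) ?_)) ?_)
      · rw [Complex.norm_exp_ofReal_mul_I]
      · simp
      · simp
      · simp
    refine h1.trans ?_
    have h2 : |x| ≤ |x| ^ 3 := le_self_pow₀ h (by norm_num)
    have h3 : |x| ^ 2 ≤ |x| ^ 3 := pow_le_pow_right₀ h (by norm_num)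
    linarith

theorem norm_exp_mul_I_sub_one_le (x : ℝ) : ‖Complex.exp (x * Complex.I) - 1‖ ≤ |x| := by
  rw [mul_comm]
  exact Real.norm_exp_I_mul_ofReal_sub_one_le

/-- `|e^a - 1| ≤ |a| e^M` as soon as `M` bounds both `0` and `Re a`. -/
theorem norm_exp_sub_one_le_mul_exp {a : ℂ} {M : ℝ} (hM : 0 ≤ M) (ha : a.re ≤ M) :
    ‖Complex.exp a - 1‖ ≤ ‖a‖ * Real.exp M := by
  have h := (convex_halfSpace_re_le M).norm_image_sub_le_of_norm_deriv_le
    (f := Complex.exp) (C := Real.exp M) (x := 0) (y := a)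
    (fun z _ => Complex.differentiable_exp z)
    (fun z hz => by
      rw [Complex.deriv_exp, Complex.norm_exp]
      exact Real.exp_le_exp.2 hz)
    (by simpa using hM) ha
  rw [mul_comm]
  simpa using h

end ElementaryBounds

/-! ### The exponent on the circle through the saddle point -/

section SaddlePoint

/-- The bracket `1 / (1 - q^{km}) - q^{(k+1)m} / (1 - q^{(k+1)m})` at `q = e^{-ε}`, which
multiplies `z^m / m` in the logarithm of the generating function. -/
noncomputable def logCoeff (k : ℕ) (ε : ℝ) (m : ℕ) : ℝ :=
  (1 - (Real.exp (-ε) ^ k) ^ m)⁻¹ -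
    (Real.exp (-ε) ^ (k + 1)) ^ m * (1 - (Real.exp (-ε) ^ (k + 1)) ^ m)⁻¹

/-- The product `A = k (k + 1) ε`, the small parameter of the saddle-point integral. -/
noncomputable def smallParam (k : ℕ) (ε : ℝ) : ℝ := k * (k + 1) * ε

theorem smallParam_pos {k : ℕ} (hk : 1 ≤ k) {ε : ℝ} (hε : 0 < ε) : 0 < smallParam k ε := by
  unfold smallParam
  positivity

theorem abs_logCoeff_sub_le {k : ℕ} (hk : 1 ≤ k) {ε : ℝ} (hε : 0 < ε) {m : ℕ} (hm : m ≠ 0) :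
    |logCoeff k ε m - 1 / (m * smallParam k ε) - 1| ≤ (4 * k + 2) * ε * m := by
  have hk0 : (0 : ℝ) < k := by exact_mod_cast hk
  have hm0 : (0 : ℝ) < m := by exact_mod_cast Nat.pos_of_ne_zero hm
  have key : ∀ j : ℕ, (Real.exp (-ε) ^ j) ^ m = Real.exp (-(j * m * ε)) := by
    intro j
    rw [← pow_mul, ← Real.exp_nat_mul]
    push_cast
    ring_nf
  have hx : 0 < (k : ℝ) * m * ε := by positivity
  have hy : 0 < ((k : ℝ) + 1) * m * ε := by positivity
  have h1 := abs_inv_one_sub_exp_neg_sub_le hx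
  have h2 := abs_inv_one_sub_exp_neg_sub_le hy
  have hd : 1 - Real.exp (-(((k : ℝ) + 1) * m * ε)) ≠ 0 :=
    (sub_pos.2 (Real.exp_lt_one_iff.2 (neg_neg_of_pos hy))).ne'
  have e : logCoeff k ε m - 1 / (m * smallParam k ε) - 1 =
      ((1 - Real.exp (-((k : ℝ) * m * ε)))⁻¹ - 1 / ((k : ℝ) * m * ε) - 1 / 2) -
      ((1 - Real.exp (-(((k : ℝ) + 1) * m * ε)))⁻¹ - 1 / (((k : ℝ) + 1) * m * ε) - 1 / 2) := by
    have e1 : Real.exp (-(((k : ℝ) + 1) * m * ε)) *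
        (1 - Real.exp (-(((k : ℝ) + 1) * m * ε)))⁻¹ =
        (1 - Real.exp (-(((k : ℝ) + 1) * m * ε)))⁻¹ - 1 := by
      field_simp
      ring
    have e2 : 1 / ((k : ℝ) * m * ε) - 1 / (((k : ℝ) + 1) * m * ε) = 1 / (m * smallParam k ε) := by
      unfold smallParam
      field_simp
      ring
    rw [logCoeff, key, key]
    push_cast
    rw [e1]
    linear_combination e2
  rw [e]
  refine (abs_sub _ _).trans ((add_le_add h1 h2).trans (le_of_eq ?_))
  ring

/-- The point of argument `v` on the circle `|z| = 1/2`, which passes through the saddle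
point `z = 1/2`. -/
noncomputable def circlePt (v : ℝ) : ℂ := Complex.exp (v * Complex.I) / 2

theorem norm_circlePt (v : ℝ) : ‖circlePt v‖ = 1 / 2 := by
  rw [circlePt, norm_div, Complex.norm_exp_ofReal_mul_I]
  simp

theorem circlePt_pow (v : ℝ) (m : ℕ) :
    circlePt v ^ m = (1 / 2) ^ m * Complex.exp ((m * v : ℝ) * Complex.I) := by
  rw [circlePt, div_eq_inv_mul, mul_pow, ← Complex.exp_nat_mul, one_div]
  push_cast
  ring_nf

/-- The logarithm of the generating function
`(q^{k+1} z; q^{k+1})_∞ / (z; q^k)_∞` at `q = e^{-ε}`. -/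
noncomputable def logGen (k : ℕ) (ε : ℝ) (z : ℂ) : ℂ :=
  qLog (Real.exp (-ε) ^ k) z -
    qLog (Real.exp (-ε) ^ (k + 1)) ((Real.exp (-ε) ^ (k + 1) : ℝ) * z)

theorem exp_neg_pow_pos (ε : ℝ) (j : ℕ) : 0 < Real.exp (-ε) ^ j := by positivity

theorem exp_neg_pow_lt_one {ε : ℝ} (hε : 0 < ε) {j : ℕ} (hj : 1 ≤ j) :
    Real.exp (-ε) ^ j < 1 :=
  pow_lt_one₀ (Real.exp_pos _).le (Real.exp_lt_one_iff.2 (neg_neg_of_pos hε)) (by omega)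

theorem hasSum_logGen {k : ℕ} (hk : 1 ≤ k) {ε : ℝ} (hε : 0 < ε) {z : ℂ} (hz : ‖z‖ ≤ 1 / 2) :
    HasSum (fun m : ℕ => (logCoeff k ε m / m : ℝ) * z ^ m) (logGen k ε z) := by
  have h1 := (summable_coeff_mul_pow (summable_qLog_coeff (exp_neg_pow_pos ε k)
    (exp_neg_pow_lt_one hε hk)) hz).hasSum
  have h2 := (summable_coeff_mul_pow (summable_qLog_coeff (exp_neg_pow_pos ε (k + 1))
    (exp_neg_pow_lt_one hε (by omega : 1 ≤ k + 1))) (norm_dilate_le (exp_neg_pow_pos ε (k + 1))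
    (exp_neg_pow_lt_one hε (by omega : 1 ≤ k + 1)) hz)).hasSum
  convert! h1.sub h2 using 1
  funext m
  rw [logCoeff, mul_pow, mul_inv, mul_inv]
  push_cast
  ring

/-- The exponent left over on the circle `|z| = 1/2` after the main factor
`2 exp (π² / (12 A) - v² / A)` is taken out of the integrand. -/
noncomputable def saddleError (k : ℕ) (ε v : ℝ) : ℂ :=
  logGen k ε (circlePt v) +
    (((Real.log 2 ^ 2 / 2 - Real.pi ^ 2 / 12) / smallParam k ε : ℝ) : ℂ) -
    ((v * Real.log 2 / smallParam k ε : ℝ) : ℂ) * Complex.I +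
    ((v ^ 2 / (2 * smallParam k ε) : ℝ) : ℂ) - ((Real.log 2 : ℝ) : ℂ)

/-- The `m`-th coefficient of `saddleError`, with the factor `2^{-m}` removed: a cubic Taylor
remainder, a linear Taylor remainder, and the error in the expansion of `logCoeff`. -/
noncomputable def saddleErrorTerm (k : ℕ) (ε v : ℝ) (m : ℕ) : ℂ :=
  ((1 / (m ^ 2 * smallParam k ε) : ℝ) : ℂ) *
      (Complex.exp ((m * v : ℝ) * Complex.I) - 1 - (m * v : ℝ) * Complex.I +
        ((m * v : ℝ) : ℂ) ^ 2 / 2) +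
    ((1 / m : ℝ) : ℂ) * (Complex.exp ((m * v : ℝ) * Complex.I) - 1) +
    (((logCoeff k ε m - 1 / (m * smallParam k ε) - 1) / m : ℝ) : ℂ) *
      Complex.exp ((m * v : ℝ) * Complex.I)

theorem hasSum_saddleError {k : ℕ} (hk : 1 ≤ k) {ε : ℝ} (hε : 0 < ε) (v : ℝ) :
    HasSum (fun m : ℕ => ((1 / 2 : ℝ) ^ m : ℝ) * saddleErrorTerm k ε v m)
      (saddleError k ε v) := by
  have hA := smallParam_pos hk hε
  have h1 := hasSum_logGen hk hε (norm_circlePt v).le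
  have h2 := Complex.hasSum_ofReal.2 (hasSum_half_pow_div_sq.mul_left (-1 / smallParam k ε))
  have h3 := (Complex.hasSum_ofReal.2
    (hasSum_half_pow_div.mul_left (v / smallParam k ε))).mul_right Complex.I
  have h4 := Complex.hasSum_ofReal.2
    (hasSum_half_pow_pos.mul_left (v ^ 2 / (2 * smallParam k ε)))
  have h5 := Complex.hasSum_ofReal.2 hasSum_half_pow_div
  convert! (((h1.add h2).sub h3).add h4).sub h5 using 1
  · funext m
    rcases eq_or_ne m 0 with rfl | hm
    · simp [saddleErrorTerm]
    · have hm' : (m : ℂ) ≠ 0 := Nat.cast_ne_zero.2 hm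
      have hA' : (smallParam k ε : ℂ) ≠ 0 := Complex.ofReal_ne_zero.2 hA.ne'
      rw [circlePt_pow, if_neg hm, saddleErrorTerm]
      generalize Complex.exp (((m * v : ℝ) : ℂ) * Complex.I) = E
      push_cast
      field_simp
      ring
  · rw [saddleError]
    push_cast
    ring

theorem norm_saddleErrorTerm_le {k : ℕ} (hk : 1 ≤ k) {ε : ℝ} (hε : 0 < ε) (v : ℝ) {m : ℕ}
    (hm : m ≠ 0) :
    ‖saddleErrorTerm k ε v m‖ ≤
      5 * |v| ^ 3 / smallParam k ε * m + (|v| + (4 * k + 2) * ε) := by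
  have hA := smallParam_pos hk hε
  have hm0 : (0 : ℝ) < m := by exact_mod_cast Nat.pos_of_ne_zero hm
  have habs : |(m : ℝ) * v| = m * |v| := by rw [abs_mul, abs_of_pos hm0]
  rw [← add_assoc]
  refine (norm_add_le _ _).trans (add_le_add ((norm_add_le _ _).trans (add_le_add ?_ ?_)) ?_)
  · rw [norm_mul, Complex.norm_real, Real.norm_of_nonneg (by positivity)]
    refine (mul_le_mul_of_nonneg_left (norm_exp_mul_I_sub_cubic_le _) (by positivity)).trans
      (le_of_eq ?_)
    rw [habs]
    field_simp
  · rw [norm_mul, Complex.norm_real, Real.norm_of_nonneg (by positivity)]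
    refine (mul_le_mul_of_nonneg_left (norm_exp_mul_I_sub_one_le _) (by positivity)).trans
      (le_of_eq ?_)
    rw [habs]
    field_simp
  · rw [norm_mul, Complex.norm_exp_ofReal_mul_I, mul_one, Complex.norm_real, norm_div,
      Real.norm_eq_abs, Real.norm_of_nonneg hm0.le, div_le_iff₀ hm0]
    exact abs_logCoeff_sub_le hk hε hm

theorem re_saddleErrorTerm_le {k : ℕ} (hk : 1 ≤ k) {ε : ℝ} (hε : 0 < ε) (v : ℝ) {m : ℕ}
    (hm : m ≠ 0) :
    (saddleErrorTerm k ε v m).re ≤ v ^ 2 / (2 * smallParam k ε) + (4 * k + 2) * ε := by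
  have hA := smallParam_pos hk hε
  have hm0 : (0 : ℝ) < m := by exact_mod_cast Nat.pos_of_ne_zero hm
  have h1 : ((((logCoeff k ε m - 1 / (m * smallParam k ε) - 1) / m : ℝ) : ℂ) *
      Complex.exp ((m * v : ℝ) * Complex.I)).re ≤ (4 * k + 2) * ε := by
    refine (Complex.re_le_norm _).trans ?_
    rw [norm_mul, Complex.norm_exp_ofReal_mul_I, mul_one, Complex.norm_real, norm_div,
      Real.norm_eq_abs, Real.norm_of_nonneg hm0.le, div_le_iff₀ hm0]
    exact abs_logCoeff_sub_le hk hε hm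
  have h2 : (Complex.exp ((m * v : ℝ) * Complex.I)).re ≤ 1 := by
    rw [Complex.exp_ofReal_mul_I_re]
    exact Real.cos_le_one _
  have h3 : (Complex.exp ((m * v : ℝ) * Complex.I) - 1 - (m * v : ℝ) * Complex.I +
      ((m * v : ℝ) : ℂ) ^ 2 / 2).re ≤ (m * v) ^ 2 / 2 := by
    have e : (((m * v : ℝ) : ℂ) ^ 2 / 2) = (((m * v) ^ 2 / 2 : ℝ) : ℂ) := by push_cast; ring
    rw [e, Complex.add_re, Complex.sub_re, Complex.sub_re, Complex.ofReal_re,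
      Complex.re_ofReal_mul, Complex.I_re, mul_zero, Complex.one_re]
    linarith
  have h4 : (Complex.exp ((m * v : ℝ) * Complex.I) - 1).re ≤ 0 := by
    rw [Complex.sub_re, Complex.one_re]
    linarith
  rw [saddleErrorTerm, Complex.add_re, Complex.add_re]
  refine add_le_add ?_ h1
  rw [Complex.re_ofReal_mul, Complex.re_ofReal_mul]
  have h5 := mul_le_mul_of_nonneg_left h3
    (by positivity : (0 : ℝ) ≤ 1 / ((m : ℝ) ^ 2 * smallParam k ε))
  have h6 := mul_le_mul_of_nonneg_left h4 (by positivity : (0 : ℝ) ≤ 1 / (m : ℝ))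
  have e : 1 / ((m : ℝ) ^ 2 * smallParam k ε) * ((m * v) ^ 2 / 2) =
      v ^ 2 / (2 * smallParam k ε) := by
    field_simp
  rw [e] at h5
  linarith

theorem saddleErrorTerm_zero (k : ℕ) (ε v : ℝ) : saddleErrorTerm k ε v 0 = 0 := by
  simp [saddleErrorTerm]

theorem norm_saddleError_le {k : ℕ} (hk : 1 ≤ k) {ε : ℝ} (hε : 0 < ε) (v : ℝ) :
    ‖saddleError k ε v‖ ≤
      10 * |v| ^ 3 / smallParam k ε + (|v| + (4 * k + 2) * ε) := by
  have hA := smallParam_pos hk hε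
  have hs := (hasSum_nat_mul_half_pow.mul_left (5 * |v| ^ 3 / smallParam k ε)).add
    (hasSum_half_pow_pos.mul_left (|v| + (4 * k + 2) * ε))
  rw [← (hasSum_saddleError hk hε v).tsum_eq]
  refine (tsum_of_norm_bounded hs fun m => ?_).trans (le_of_eq (by ring))
  rcases eq_or_ne m 0 with rfl | hm
  · simp [saddleErrorTerm_zero]
  · rw [norm_mul, Complex.norm_real, Real.norm_of_nonneg (by positivity), if_neg hm]
    refine (mul_le_mul_of_nonneg_left (norm_saddleErrorTerm_le hk hε v hm)
      (by positivity)).trans (le_of_eq (by ring))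

/-- No oscillation is needed off the saddle point: `Re Li₂` is maximal at the positive real
point of the circle, so half of the Gaussian `exp (-v² / A)` survives. -/
theorem re_saddleError_le {k : ℕ} (hk : 1 ≤ k) {ε : ℝ} (hε : 0 < ε) (v : ℝ) :
    (saddleError k ε v).re ≤ v ^ 2 / (2 * smallParam k ε) + (4 * k + 2) * ε := by
  have h1 := Complex.hasSum_re (hasSum_saddleError hk hε v)
  have h2 := hasSum_half_pow_pos.mul_left (v ^ 2 / (2 * smallParam k ε) + (4 * k + 2) * ε)
  refine (hasSum_le (fun m => ?_) h1 h2).trans (le_of_eq (mul_one _))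
  rcases eq_or_ne m 0 with rfl | hm
  · simp [saddleErrorTerm_zero]
  · rw [Complex.re_ofReal_mul, if_neg hm, mul_comm]
    exact mul_le_mul_of_nonneg_right (re_saddleErrorTerm_le hk hε v hm) (by positivity)

end SaddlePoint

/-! ### The double series as an integral -/

section GaussianIntegral

open MeasureTheory

/-- The Gaussian kernel whose pairing with `z^N` on the circle `|z| = 1/2`, at the point of
argument `√A w`, is `√(2π) exp (-A N² / 2)`. -/
noncomputable def gaussKernel (k : ℕ) (ε w : ℝ) : ℂ :=
  Complex.exp (((Real.log 2 ^ 2 / (2 * smallParam k ε) : ℝ) : ℂ) - ((w ^ 2 / 2 : ℝ) : ℂ) -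
    ((√(smallParam k ε) * w * Real.log 2 / smallParam k ε : ℝ) : ℂ) * Complex.I)

theorem circlePt_pow_eq_exp (v : ℝ) (N : ℕ) :
    circlePt v ^ N =
      Complex.exp (((-(N * Real.log 2) : ℝ) : ℂ) + ((N * v : ℝ) : ℂ) * Complex.I) := by
  rw [circlePt_pow, Complex.exp_add, ← Complex.ofReal_exp,
    show -(N * Real.log 2) = (N : ℝ) * Real.log (1 / 2) by rw [one_div, Real.log_inv]; ring,
    Real.exp_nat_mul, Real.exp_log (by norm_num)]
  push_cast
  rfl

theorem circlePt_pow_mul_gaussKernel (k : ℕ) (ε w : ℝ) (N : ℕ) :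
    circlePt (√(smallParam k ε) * w) ^ N * gaussKernel k ε w =
      Complex.exp (-(1 / 2 : ℂ) * (w : ℂ) ^ 2 +
        ((N * √(smallParam k ε) - √(smallParam k ε) * Real.log 2 / smallParam k ε : ℝ) : ℂ) *
          Complex.I * (w : ℂ) +
        ((Real.log 2 ^ 2 / (2 * smallParam k ε) - N * Real.log 2 : ℝ) : ℂ)) := by
  rw [circlePt_pow_eq_exp, gaussKernel, ← Complex.exp_add]
  congr 1
  push_cast
  ring

theorem integrable_circlePt_pow_mul_gaussKernel (k : ℕ) (ε : ℝ) (N : ℕ) :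
    Integrable fun w => circlePt (√(smallParam k ε) * w) ^ N * gaussKernel k ε w := by
  simp only [circlePt_pow_mul_gaussKernel]
  exact integrable_cexp_quadratic (by norm_num) _ _

theorem integral_circlePt_pow_mul_gaussKernel {k : ℕ} (hk : 1 ≤ k) {ε : ℝ} (hε : 0 < ε) (N : ℕ) :
    ∫ w, circlePt (√(smallParam k ε) * w) ^ N * gaussKernel k ε w =
      ((√(2 * Real.pi) * Real.exp (-(smallParam k ε * N ^ 2 / 2)) : ℝ) : ℂ) := by
  have hA := smallParam_pos hk hε
  have hB := Real.sq_sqrt hA.le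
  simp only [circlePt_pow_mul_gaussKernel]
  rw [integral_cexp_quadratic (by norm_num)]
  have h1 : ((Real.pi : ℂ) / -(-(1 / 2))) ^ (1 / 2 : ℂ) = ((√(2 * Real.pi) : ℝ) : ℂ) := by
    rw [Real.sqrt_eq_rpow, Complex.ofReal_cpow (by positivity)]
    push_cast
    congr 1
    ring
  rw [h1]
  push_cast
  congr 2
  have e : ((N : ℝ) * √(smallParam k ε) -
      √(smallParam k ε) * Real.log 2 / smallParam k ε) ^ 2 =
      smallParam k ε * N ^ 2 - 2 * N * Real.log 2 + Real.log 2 ^ 2 / smallParam k ε := by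
    have : (N : ℝ) * √(smallParam k ε) - √(smallParam k ε) * Real.log 2 / smallParam k ε =
      √(smallParam k ε) * (N - Real.log 2 / smallParam k ε) := by ring
    rw [this, mul_pow, hB]
    field_simp
    ring
  have e' : ((N : ℂ) * (√(smallParam k ε) : ℝ) -
      (√(smallParam k ε) : ℝ) * (Real.log 2 : ℝ) / (smallParam k ε : ℝ)) ^ 2 =
      (smallParam k ε : ℝ) * (N : ℂ) ^ 2 - 2 * N * (Real.log 2 : ℝ) +
        (Real.log 2 : ℝ) ^ 2 / (smallParam k ε : ℝ) := by exact_mod_cast e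
  rw [mul_pow, Complex.I_sq, e']
  have hA' : ((smallParam k ε : ℝ) : ℂ) ≠ 0 := Complex.ofReal_ne_zero.2 hA.ne'
  field_simp
  ring

/-- The terms of the double series factor into the coefficients of Euler's expansions and a
Gaussian in `r + s`. -/
theorem term_exp_neg (k : ℕ) (ε : ℝ) (p : ℕ × ℕ) :
    term k (Real.exp (-ε)) p =
      eulerCoeff (Real.exp (-ε) ^ k) p.1 * eulerCoeff' (Real.exp (-ε) ^ (k + 1)) p.2 *
        Real.exp (-(smallParam k ε * ((p.1 + p.2 : ℕ) : ℝ) ^ 2 / 2)) := by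
  obtain ⟨r, s⟩ := p
  have h : (2 : ℝ) * exponent k r s =
      k * (k + 1) * (r + s) ^ 2 + (k + 1) * (s * (s + 1)) := by
    exact_mod_cast two_mul_exponent k r s
  have hs : (2 : ℝ) * ((s * (s + 1) / 2 : ℕ) : ℝ) = s * (s + 1) := by
    exact_mod_cast Nat.mul_div_cancel' (Nat.even_mul_succ_self s).two_dvd
  have e : Real.exp (-ε) ^ exponent k r s =
      (Real.exp (-ε) ^ (k + 1)) ^ (s * (s + 1) / 2) *
        Real.exp (-(smallParam k ε * ((r + s : ℕ) : ℝ) ^ 2 / 2)) := by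
    rw [← pow_mul, ← Real.exp_nat_mul, ← Real.exp_nat_mul, ← Real.exp_add, smallParam]
    congr 1
    push_cast
    linear_combination (-ε / 2) * h + (k + 1) * ε / 2 * hs
  simp only [term, eulerCoeff', eulerCoeff, e]
  field_simp

theorem norm_circlePt_pow_mul_gaussKernel (k : ℕ) (ε w : ℝ) (p : ℕ × ℕ) :
    ‖circlePt (√(smallParam k ε) * w) ^ (p.1 + p.2) * gaussKernel k ε w‖ =
      (1 / 2) ^ p.1 * (1 / 2) ^ p.2 * ‖gaussKernel k ε w‖ := by
  rw [norm_mul, norm_pow, norm_circlePt, pow_add]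

/-- On the circle, the generating function times the Gaussian kernel is the main exponential
factor times a Gaussian, up to `saddleError`. -/
theorem exp_logGen_mul_gaussKernel {k : ℕ} (hk : 1 ≤ k) {ε : ℝ} (hε : 0 < ε) (w : ℝ) :
    Complex.exp (logGen k ε (circlePt (√(smallParam k ε) * w))) * gaussKernel k ε w =
      ((2 * Real.exp (Real.pi ^ 2 / (12 * smallParam k ε)) : ℝ) : ℂ) *
        (Complex.exp (saddleError k ε (√(smallParam k ε) * w)) * (Real.exp (-w ^ 2) : ℝ)) := by
  have hA := smallParam_pos hk hε
  have e : (√(smallParam k ε) * w) ^ 2 / (2 * smallParam k ε) = w ^ 2 / 2 := by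
    rw [mul_pow, Real.sq_sqrt hA.le]
    field_simp
  have e2 : 2 * Real.exp (Real.pi ^ 2 / (12 * smallParam k ε)) =
      Real.exp (Real.log 2 + Real.pi ^ 2 / (12 * smallParam k ε)) := by
    rw [Real.exp_add, Real.exp_log two_pos]
  rw [saddleError, gaussKernel, e, e2]
  have hA' : ((smallParam k ε : ℝ) : ℂ) ≠ 0 := Complex.ofReal_ne_zero.2 hA.ne'
  push_cast
  rw [← Complex.exp_add, ← Complex.exp_add, ← Complex.exp_add]
  congr 1
  field_simp
  ring

theorem tsum_euler_mul_pow {k : ℕ} (hk : 1 ≤ k) {ε : ℝ} (hε : 0 < ε) {z : ℂ} (hz : ‖z‖ ≤ 1 / 2) :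
    ∑' p : ℕ × ℕ, ((eulerCoeff (Real.exp (-ε) ^ k) p.1 *
      eulerCoeff' (Real.exp (-ε) ^ (k + 1)) p.2 : ℝ) : ℂ) * z ^ (p.1 + p.2) =
      Complex.exp (logGen k ε z) := by
  have hp0 := exp_neg_pow_pos ε k
  have hp1 := exp_neg_pow_lt_one hε hk
  have hq0 := exp_neg_pow_pos ε (k + 1)
  have hq1 := exp_neg_pow_lt_one hε (by omega : 1 ≤ k + 1)
  rw [logGen, sub_eq_add_neg, Complex.exp_add, ← eulerSeries_eq_exp hp0 hp1 hz,
    ← eulerSeries'_eq_exp hq0 hq1 hz, tsum_mul_tsum_of_summable_norm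
      (summable_norm_coeff_mul_pow (summable_eulerCoeff hp0 hp1) hz)
      (summable_norm_coeff_mul_pow (summable_eulerCoeff' hq0 hq1) hz)]
  refine tsum_congr fun p => ?_
  rw [pow_add]
  push_cast
  ring

/-- The double series as a saddle-point integral. -/
theorem hasSum_term {k : ℕ} (hk : 1 ≤ k) {ε : ℝ} (hε : 0 < ε) :
    HasSum (fun p => ((√(2 * Real.pi) * term k (Real.exp (-ε)) p : ℝ) : ℂ))
      (((2 * Real.exp (Real.pi ^ 2 / (12 * smallParam k ε)) : ℝ) : ℂ) *
        ∫ w, Complex.exp (saddleError k ε (√(smallParam k ε) * w)) *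
          (Real.exp (-w ^ 2) : ℝ)) := by
  have hp0 := exp_neg_pow_pos ε k
  have hp1 := exp_neg_pow_lt_one hε hk
  have hq0 := exp_neg_pow_pos ε (k + 1)
  have hq1 := exp_neg_pow_lt_one hε (by omega : 1 ≤ k + 1)
  have h := hasSum_integral_of_summable_integral_norm (μ := volume)
    (F := fun (p : ℕ × ℕ) w => ((eulerCoeff (Real.exp (-ε) ^ k) p.1 *
      eulerCoeff' (Real.exp (-ε) ^ (k + 1)) p.2 : ℝ) : ℂ) *
      (circlePt (√(smallParam k ε) * w) ^ (p.1 + p.2) * gaussKernel k ε w))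
    (fun p => (integrable_circlePt_pow_mul_gaussKernel k ε _).const_mul _) ?_
  · convert! h using 1
    · funext p
      rw [integral_const_mul, integral_circlePt_pow_mul_gaussKernel hk hε, term_exp_neg]
      push_cast
      ring
    · rw [← integral_const_mul]
      refine integral_congr_ae (Eventually.of_forall fun w => ?_)
      simp only
      rw [← exp_logGen_mul_gaussKernel hk hε, ← tsum_euler_mul_pow hk hε (norm_circlePt _).le,
        ← tsum_mul_right]
      simp only [mul_assoc]
  · have hs := ((summable_eulerCoeff hp0 hp1).mul_of_nonneg (summable_eulerCoeff' hq0 hq1)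
      (fun n => by positivity) (fun n => by positivity)).mul_right
      (∫ w, ‖gaussKernel k ε w‖)
    refine hs.congr fun p => ?_
    simp only [norm_mul _ (circlePt _ ^ _ * _), norm_circlePt_pow_mul_gaussKernel, integral_const_mul]
    rw [Complex.ofReal_mul, norm_mul]
    ring

end GaussianIntegral

/-! ### Size of the error -/

section ErrorBound

open MeasureTheory

theorem continuous_circlePt : Continuous circlePt := by
  unfold circlePt
  fun_prop

theorem continuous_saddleError {k : ℕ} (hk : 1 ≤ k) {ε : ℝ} (hε : 0 < ε) :
    Continuous (saddleError k ε) := by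
  have hp0 := exp_neg_pow_pos ε k
  have hp1 := exp_neg_pow_lt_one hε hk
  have hq0 := exp_neg_pow_pos ε (k + 1)
  have hq1 := exp_neg_pow_lt_one hε (by omega : 1 ≤ k + 1)
  have h1 : Continuous fun v => qLog (Real.exp (-ε) ^ k) (circlePt v) :=
    (continuousOn_powerSeries (summable_qLog_coeff hp0 hp1)).comp_continuous continuous_circlePt
      fun v => mem_closedBall_zero_iff.2 (norm_circlePt v).le
  have h2 : Continuous fun v => qLog (Real.exp (-ε) ^ (k + 1))
      ((Real.exp (-ε) ^ (k + 1) : ℝ) * circlePt v) :=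
    (continuousOn_powerSeries (summable_qLog_coeff hq0 hq1)).comp_continuous
      (continuous_const.mul continuous_circlePt)
      fun v => mem_closedBall_zero_iff.2 (norm_dilate_le hq0 hq1 (norm_circlePt v).le)
  unfold saddleError logGen
  fun_prop

/-- The function `(10 |w|³ + |w| + 1) e^{-w²/2}` that dominates the error integrand, up to a
constant multiple of `√ε`. -/
noncomputable def majorant (w : ℝ) : ℝ :=
  (10 * |w| ^ 3 + |w| + 1) * Real.exp (-(1 / 2) * w ^ 2)

theorem integrable_majorant : Integrable majorant := by
  have h : ∀ n : ℕ, Integrable fun w : ℝ => |w| ^ n * Real.exp (-(1 / 2) * w ^ 2) := by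
    intro n
    have h0 := (integrable_rpow_mul_exp_neg_mul_sq (b := 1 / 2) (by norm_num) (s := n)
      (by linarith [n.cast_nonneg (α := ℝ)])).norm
    refine h0.congr (Eventually.of_forall fun w => ?_)
    simp only [Real.rpow_natCast, norm_mul, norm_pow, Real.norm_eq_abs, Real.abs_exp]
  refine ((((h 3).const_mul 10).add (h 1)).add (h 0)).congr (Eventually.of_forall fun w => ?_)
  simp only [majorant, Pi.add_apply]
  ring

/-- The constant in front of `√ε` in the bound for the error integrand. -/
noncomputable def errorConst (k : ℕ) : ℝ :=
  (√(k * (k + 1)) + (4 * k + 2)) * Real.exp (4 * k + 2)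

theorem norm_error_integrand_le {k : ℕ} (hk : 1 ≤ k) {ε : ℝ} (hε : 0 < ε) (hε1 : ε ≤ 1) (w : ℝ) :
    ‖(Complex.exp (saddleError k ε (√(smallParam k ε) * w)) - 1) * (Real.exp (-w ^ 2) : ℝ)‖ ≤
      √ε * errorConst k * majorant w := by
  have hA := smallParam_pos hk hε
  have hB0 : 0 < √(smallParam k ε) := Real.sqrt_pos.2 hA
  have hB := Real.sq_sqrt hA.le
  have hBε : √(smallParam k ε) = √(k * (k + 1)) * √ε := by
    rw [smallParam, Real.sqrt_mul (by positivity)]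
  have hεs : ε ≤ √ε := Real.le_sqrt_of_sq_le (by nlinarith)
  have hn := norm_saddleError_le hk hε (√(smallParam k ε) * w)
  have hr := re_saddleError_le hk hε (√(smallParam k ε) * w)
  have e1 : 10 * |√(smallParam k ε) * w| ^ 3 / smallParam k ε =
      √(smallParam k ε) * (10 * |w| ^ 3) := by
    rw [abs_mul, abs_of_pos hB0, div_eq_iff hA.ne']
    linear_combination 10 * √(smallParam k ε) * |w| ^ 3 * hB
  have e2 : (√(smallParam k ε) * w) ^ 2 / (2 * smallParam k ε) = w ^ 2 / 2 := by
    rw [mul_pow, hB]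
    field_simp
  rw [e1, abs_mul, abs_of_pos hB0] at hn
  rw [e2] at hr
  have hr' : (saddleError k ε (√(smallParam k ε) * w)).re ≤ w ^ 2 / 2 + (4 * k + 2) := by
    have : (4 * (k : ℝ) + 2) * ε ≤ 4 * k + 2 := mul_le_of_le_one_right (by positivity) hε1
    linarith
  have hn' : ‖saddleError k ε (√(smallParam k ε) * w)‖ ≤
      √ε * (√(k * (k + 1)) + (4 * k + 2)) * (10 * |w| ^ 3 + |w| + 1) := by
    refine hn.trans ?_
    rw [hBε]
    have h1 : (4 * (k : ℝ) + 2) * ε ≤ (4 * k + 2) * √ε := by gcongr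
    have h2 : (0 : ℝ) ≤ √ε * √(k * (k + 1)) := by positivity
    have h3 : (0 : ℝ) ≤ √ε * (4 * k + 2) * (10 * |w| ^ 3 + |w|) := by positivity
    linarith
  rw [norm_mul, Complex.norm_real, Real.norm_of_nonneg (Real.exp_pos _).le]
  calc _ ≤ (√ε * (√(k * (k + 1)) + (4 * k + 2)) * (10 * |w| ^ 3 + |w| + 1)) *
        Real.exp (w ^ 2 / 2 + (4 * k + 2)) * Real.exp (-w ^ 2) := by
        gcongr
        exact (norm_exp_sub_one_le_mul_exp (by positivity) hr').trans (by gcongr)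
    _ = √ε * errorConst k * majorant w := by
        rw [errorConst, majorant, mul_assoc, ← Real.exp_add,
          show w ^ 2 / 2 + (4 * k + 2) + -w ^ 2 = (4 * k + 2) + -(1 / 2) * w ^ 2 by ring,
          Real.exp_add]
        ring

theorem norm_integral_exp_saddleError_sub_le {k : ℕ} (hk : 1 ≤ k) {ε : ℝ} (hε : 0 < ε)
    (hε1 : ε ≤ 1) :
    ‖(∫ w, Complex.exp (saddleError k ε (√(smallParam k ε) * w)) * (Real.exp (-w ^ 2) : ℝ)) -
      (√Real.pi : ℝ)‖ ≤ √ε * errorConst k * ∫ w, majorant w := by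
  have hg : Integrable fun w : ℝ => ((Real.exp (-w ^ 2) : ℝ) : ℂ) := by
    have := (integrable_exp_neg_mul_sq (b := 1) one_pos).ofReal (𝕜 := ℂ)
    simpa using this
  have hgi : ∫ w : ℝ, ((Real.exp (-w ^ 2) : ℝ) : ℂ) = (√Real.pi : ℝ) := by
    rw [integral_complex_ofReal]
    simpa using congrArg Complex.ofReal (integral_gaussian 1)
  have hb := integrable_majorant.const_mul (√ε * errorConst k)
  have hcont := continuous_saddleError hk hε
  have hd : Integrable fun w : ℝ =>
      (Complex.exp (saddleError k ε (√(smallParam k ε) * w)) - 1) * (Real.exp (-w ^ 2) : ℝ) :=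
    hb.mono' (by fun_prop) (Eventually.of_forall (norm_error_integrand_le hk hε hε1))
  have e : ∫ w, Complex.exp (saddleError k ε (√(smallParam k ε) * w)) * (Real.exp (-w ^ 2) : ℝ) =
      (∫ w : ℝ, (Complex.exp (saddleError k ε (√(smallParam k ε) * w)) - 1) *
        (Real.exp (-w ^ 2) : ℝ)) + (√Real.pi : ℝ) := by
    rw [← hgi, ← integral_add hd hg]
    refine integral_congr_ae (Eventually.of_forall fun w => ?_)
    simp only
    ring
  rw [e, add_sub_cancel_right, ← integral_const_mul]
  exact norm_integral_le_of_norm_le hb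
    (Eventually.of_forall (norm_error_integrand_le hk hε hε1))

theorem summable_term_exp_neg {k : ℕ} (hk : 1 ≤ k) {ε : ℝ} (hε : 0 < ε) :
    Summable (term k (Real.exp (-ε))) := by
  have h := Complex.summable_ofReal.1 (hasSum_term hk hε).summable
  rwa [summable_mul_left_iff (by positivity)] at h

/-- The normalised error `H / (√2 exp (π² / (12 A))) - 1` is at most a constant times `√ε`. -/
theorem abs_H_div_sub_one_le {k : ℕ} (hk : 1 ≤ k) {ε : ℝ} (hε : 0 < ε) (hε1 : ε ≤ 1) :
    |H k (Real.exp (-ε)) / (√2 * Real.exp (Real.pi ^ 2 / (12 * smallParam k ε))) - 1| ≤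
      (errorConst k * ∫ w, majorant w) / √Real.pi * √ε := by
  have hM := Real.exp_pos (Real.pi ^ 2 / (12 * smallParam k ε))
  have hpi : 0 < √Real.pi := Real.sqrt_pos.2 Real.pi_pos
  have h2 : (0 : ℝ) < √2 := by positivity
  have h22 : √2 * √2 = (2 : ℝ) := Real.mul_self_sqrt (by norm_num)
  have hH : ((√(2 * Real.pi) * H k (Real.exp (-ε)) : ℝ) : ℂ) =
      ((2 * Real.exp (Real.pi ^ 2 / (12 * smallParam k ε)) : ℝ) : ℂ) *
        ∫ w, Complex.exp (saddleError k ε (√(smallParam k ε) * w)) *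
          (Real.exp (-w ^ 2) : ℝ) := by
    rw [← (hasSum_term hk hε).tsum_eq, ← Complex.ofReal_tsum, tsum_mul_left, H]
  have hb := norm_integral_exp_saddleError_sub_le hk hε hε1
  generalize (∫ w, Complex.exp (saddleError k ε (√(smallParam k ε) * w)) *
    (Real.exp (-w ^ 2) : ℝ)) = J at hH hb
  generalize Real.exp (Real.pi ^ 2 / (12 * smallParam k ε)) = M at *
  have hJ : J = ((√Real.pi * (H k (Real.exp (-ε)) / (√2 * M)) : ℝ) : ℂ) := by
    have hM' : ((2 * M : ℝ) : ℂ) ≠ 0 := Complex.ofReal_ne_zero.2 (by positivity)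
    refine mul_left_cancel₀ hM' (hH.symm.trans ?_)
    rw [← Complex.ofReal_mul, Real.sqrt_mul (by norm_num)]
    congr 1
    field_simp
    linear_combination H k (Real.exp (-ε)) * h22
  rw [hJ, ← Complex.ofReal_sub, Complex.norm_real, Real.norm_eq_abs,
    show √Real.pi * (H k (Real.exp (-ε)) / (√2 * M)) - √Real.pi =
      √Real.pi * (H k (Real.exp (-ε)) / (√2 * M) - 1) by ring, abs_mul, abs_of_pos hpi] at hb
  rw [div_mul_eq_mul_div, le_div_iff₀ hpi]
  linarith

end ErrorBound

end RunOverpartition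

theorem proposition3p1 (k : ℕ) (hk : 1 ≤ k) :
    (∀ q : ℝ, 0 < q → q < 1 → Summable (RunOverpartition.term k q)) ∧
    ∃ R : ℝ → ℝ,
      R =O[𝓝[>] (0 : ℝ)] (fun ε : ℝ => ε ^ (1 / 2 : ℝ)) ∧
      ∀ ε : ℝ, 0 < ε →
        RunOverpartition.H k (Real.exp (-ε)) =
          Real.sqrt 2 * Real.exp (Real.pi ^ 2 / (12 * (k : ℝ) * ((k : ℝ) + 1) * ε)) *
            (1 + R ε) := by
  refine ⟨fun q hq0 hq1 => ?_, fun ε => RunOverpartition.H k (Real.exp (-ε)) /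
    (√2 * Real.exp (Real.pi ^ 2 / (12 * RunOverpartition.smallParam k ε))) - 1, ?_, ?_⟩
  · have h := RunOverpartition.summable_term_exp_neg hk (neg_pos.2 (Real.log_neg hq0 hq1))
    rwa [neg_neg, Real.exp_log hq0] at h
  · refine IsBigO.of_bound ((RunOverpartition.errorConst k *
      ∫ w, RunOverpartition.majorant w) / √Real.pi) ?_
    filter_upwards [Ioc_mem_nhdsGT (zero_lt_one (α := ℝ))] with ε hε
    rw [Real.norm_eq_abs, ← Real.sqrt_eq_rpow, Real.norm_of_nonneg (Real.sqrt_nonneg ε)]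
    exact RunOverpartition.abs_H_div_sub_one_le hk hε.1 hε.2
  · intro ε _
    have e : 12 * RunOverpartition.smallParam k ε = 12 * (k : ℝ) * ((k : ℝ) + 1) * ε := by
      rw [RunOverpartition.smallParam]
      ring
    beta_reduce
    rw [e, add_sub_cancel, mul_div_cancel₀ _ (by positivity)]
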